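/- Let $\mathcal P(r)$ be the manifold of symmetric positive definite real $r\times r$ matrices with tangent spaces $T_x\mathcal P(r)=\mathrm{Sym}(r)$ and the affine-invariant Riemannian metric $\langle\eta_1,\eta_2\rangle_x=\operatorname{tr}(\eta_1x^{-1}\eta_2x^{-1})$. Let $x,z\in\mathcal P(r)$ with $x\neq z$, let $T=d_{\mathcal P}(x,z)=\|\operatorname{Log}(x^{-1/2}zx^{-1/2})\|$ (Frobenius norm) be their geodesic distance, and let $\gamma$ be the unit speed geodesic with $\gamma(0)=x$ and $\gamma(T)=z$. Put $\upsilon=\dot\gamma(0)$ and let $v_1,\dots,v_r$ be an orthonormal basis of $\mathbb R^r$ and $\lambda_1,\dots,\lambda_r$ real numbers with $$x^{-1/2}\,\upsilon\,x^{-1/2}=\sum_{i=1}^r\lambda_i v_iv_i^{\mathrm T}.$$ For $1\le i\le j\le r$ let $$\xi_{ij}=\begin{cases}\tfrac12\,x^{1/2}(v_iv_j^{\mathrm T}+v_jv_i^{\mathrm T})x^{1/2}, & i=j,\\[1ex] \tfrac1{\sqrt2}\,x^{1/2}(v_iv_j^{\mathrm T}+v_jv_i^{\mathrm T})x^{1/2},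 & i\ne j,\end{cases}$$ and let $\Xi_{ij}$ be the parallel vector field along $\gamma$ (with respect to the Levi-Civita connection) with $\Xi_{ij}(0)=\xi_{ij}$. Let $c(y)$ denote the midpoint of the geodesic joining $y\in\mathcal P(r)$ and $z$. Then $c$ is differentiable at $x$, and for all $1\le i\le j\le r$ its differential satisfies $$D_xc[\xi_{ij}]=\begin{cases}\tfrac12\,\Xi_{ij}(\tfrac T2), & \lambda_i=\lambda_j,\\[1ex] \dfrac{\sinh\left(\frac T4|\lambda_i-\lambda_j|\right)}{\sinh\left(\frac T2|\lambda_i-\lambda_j|\right)}\,\Xi_{ij}(\tfrac T2), & \lambda_i\neq\lambda_j.\end{cases}$$ -/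

import Mathlib

/-- The affine-invariant Riemannian metric on the manifold `P(r)` of symmetric positive definite
`r × r` matrices: `⟨η, ζ⟩_x = tr (η x⁻¹ ζ x⁻¹)`.  `P(r)` is an open subset of the vector space
`Sym(r)` of symmetric matrices, so its tangent space at every point is `Sym(r)`. -/
noncomputable def spdMetric {r : ℕ} (x η ζ : Matrix (Fin r) (Fin r) ℝ) : ℝ :=
  (η * x⁻¹ * ζ * x⁻¹).trace

/-- `Γ` is the Christoffel form (in the global chart `P(r) ⊆ Sym(r)`) of the Levi-Civita
connection of the affine-invariant metric, i.e. `∇_η Z = DZ[η] + Γ_x(η, Z)`: it takes symmetric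
values, is torsion-free, and is compatible with the metric. -/
structure IsSpdLeviCivita {r : ℕ}
    (Γ : Matrix (Fin r) (Fin r) ℝ → Matrix (Fin r) (Fin r) ℝ → Matrix (Fin r) (Fin r) ℝ →
      Matrix (Fin r) (Fin r) ℝ) : Prop where
  symm_valued : ∀ x η ζ, x.PosDef → η.IsSymm → ζ.IsSymm → (Γ x η ζ).IsSymm
  torsion_free : ∀ x η ζ, x.PosDef → η.IsSymm → ζ.IsSymm → Γ x η ζ = Γ x ζ η
  metric : ∀ x η ζ θ, x.PosDef → η.IsSymm → ζ.IsSymm → θ.IsSymm →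
    HasDerivAt (fun s : ℝ => spdMetric (x + s • η) ζ θ)
      (spdMetric x (Γ x η ζ) θ + spdMetric x ζ (Γ x η θ)) 0

/-- The Christoffel form of the Levi-Civita connection of the affine-invariant metric; see
`isSpdLeviCivita_spdChristoffel` and `IsSpdLeviCivita.eq_spdChristoffel`. -/
noncomputable def spdChristoffel {r : ℕ} (x η ζ : Matrix (Fin r) (Fin r) ℝ) :
    Matrix (Fin r) (Fin r) ℝ :=
  -((1 / 2 : ℝ) • (η * x⁻¹ * ζ + ζ * x⁻¹ * η))

theorem spdMetric_comm {r : ℕ} (x η ζ : Matrix (Fin r) (Fin r) ℝ) :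
    spdMetric x η ζ = spdMetric x ζ η := by
  unfold spdMetric
  rw [Matrix.mul_assoc (η * x⁻¹), Matrix.trace_mul_comm, ← Matrix.mul_assoc]

open scoped MatrixOrder Matrix.Norms.L2Operator in
theorem eq_zero_of_spdMetric_self {r : ℕ} {x η : Matrix (Fin r) (Fin r) ℝ} (hx : x.PosDef)
    (hη : η.IsSymm) (h : spdMetric x η η = 0) : η = 0 := by
  obtain ⟨B, hxB⟩ := CStarAlgebra.nonneg_iff_eq_star_mul_self.1 hx.inv.posSemidef.nonneg
  rw [Matrix.star_eq_conjTranspose] at hxB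
  have hB : IsUnit B := isUnit_of_mul_isUnit_right (x := B.conjTranspose) (hxB ▸ hx.inv.isUnit)
  have h1 : ((B * η * B.conjTranspose).conjTranspose * (B * η * B.conjTranspose)).trace = 0 := by
    have hs : η.conjTranspose = η := by
      rw [Matrix.conjTranspose_eq_transpose_of_trivial]
      exact hη
    rw [spdMetric, hxB] at h
    rw [← h, Matrix.conjTranspose_mul, Matrix.conjTranspose_mul, hs,
      Matrix.conjTranspose_conjTranspose, Matrix.trace_mul_comm]
    simp only [Matrix.mul_assoc]
    rw [Matrix.trace_mul_comm]
    simp only [Matrix.mul_assoc]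
  rw [Matrix.trace_conjTranspose_mul_self_eq_zero_iff] at h1
  have hB2 : IsUnit B.conjTranspose := hB.star
  rw [hB2.mul_left_eq_zero, hB.mul_right_eq_zero] at h1
  exact h1

section LeviCivita

attribute [local instance] Matrix.linftyOpNormedRing Matrix.linftyOpNormedAlgebra

/-- `spdChristoffel` is the Christoffel form of the Levi-Civita connection. -/
theorem isSpdLeviCivita_spdChristoffel {r : ℕ} :
    IsSpdLeviCivita (spdChristoffel (r := r)) where
  symm_valued x η ζ hx hη hζ := by
    have hx' : x.transpose = x := by simpa using hx.1.eq
    unfold Matrix.IsSymm at *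
    simp [spdChristoffel, Matrix.transpose_mul, Matrix.transpose_nonsing_inv, hx', hη, hζ,
      Matrix.mul_assoc, add_comm]
  torsion_free x η ζ _ _ _ := by
    simp [spdChristoffel, add_comm]
  metric x η ζ θ hx hη hζ hθ := by
    have hu : IsUnit x := hx.isUnit
    obtain ⟨u, rfl⟩ := hu
    have h1 : HasDerivAt (fun s : ℝ => (u : Matrix (Fin r) (Fin r) ℝ) + s • η) η 0 := by
      have := ((hasDerivAt_id (0 : ℝ)).smul_const η).const_add (u : Matrix (Fin r) (Fin r) ℝ)
      rw [one_smul] at this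
      exact this
    have h2 := (hasFDerivAt_ringInverse (𝕜 := ℝ) u)
    have h3 : HasDerivAt (fun s : ℝ => ((u : Matrix (Fin r) (Fin r) ℝ) + s • η)⁻¹)
        (-((u : Matrix (Fin r) (Fin r) ℝ)⁻¹ * η * (u : Matrix (Fin r) (Fin r) ℝ)⁻¹)) 0 := by
      have h4 := HasFDerivAt.comp_hasDerivAt_of_eq (0 : ℝ) h2 h1 (by simp)
      simp [Function.comp_def, ← Matrix.nonsing_inv_eq_ringInverse] at h4
      exact h4
    have h5 := ((h3.const_mul ζ).mul (h3.const_mul θ))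
    have h6 := ((Matrix.traceLinearMap (Fin r) ℝ ℝ).toContinuousLinearMap.hasFDerivAt).comp_hasDerivAt
      (0 : ℝ) h5
    refine (h6.congr_deriv ?_).congr_of_eventuallyEq (.of_forall fun s => ?_)
    · change Matrix.trace (_ : Matrix (Fin r) (Fin r) ℝ) = _
      simp only [spdMetric, spdChristoffel, zero_smul, add_zero]
      set y := (u : Matrix (Fin r) (Fin r) ℝ)⁻¹
      have hc : (η * (y * (ζ * (y * (θ * y))))).trace = (ζ * (y * (θ * (y * (η * y))))).trace := by
        have := Matrix.trace_mul_comm (η * y) (ζ * y * θ * y)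
        simpa only [Matrix.mul_assoc] using this
      simp only [mul_neg, neg_mul, add_mul, mul_add, smul_mul_assoc, mul_smul_comm,
        Matrix.trace_add, Matrix.trace_neg, Matrix.trace_smul, smul_eq_mul, Matrix.mul_assoc,
        smul_add]
      linarith
    · simp [spdMetric, Matrix.mul_assoc]

/-- The Levi-Civita connection is unique. -/
theorem IsSpdLeviCivita.eq_spdChristoffel {r : ℕ}
    {Γ : Matrix (Fin r) (Fin r) ℝ → Matrix (Fin r) (Fin r) ℝ → Matrix (Fin r) (Fin r) ℝ →
      Matrix (Fin r) (Fin r) ℝ} (h : IsSpdLeviCivita Γ) {x η ζ : Matrix (Fin r) (Fin r) ℝ}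
    (hx : x.PosDef) (hη : η.IsSymm) (hζ : ζ.IsSymm) : Γ x η ζ = spdChristoffel x η ζ := by
  have h0 := isSpdLeviCivita_spdChristoffel (r := r)
  have hsub : ∀ a b c : Matrix (Fin r) (Fin r) ℝ,
      spdMetric x (a - b) c = spdMetric x a c - spdMetric x b c := by
    intro a b c
    simp [spdMetric, sub_mul, Matrix.trace_sub]
  have key : ∀ a b c : Matrix (Fin r) (Fin r) ℝ, a.IsSymm → b.IsSymm → c.IsSymm →
      spdMetric x (Γ x a b - spdChristoffel x a b) c =
        -spdMetric x (Γ x a c - spdChristoffel x a c) b := by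
    intro a b c ha hb hc
    have := (h.metric x a b c hx ha hb hc).unique (h0.metric x a b c hx ha hb hc)
    rw [hsub, hsub]
    rw [spdMetric_comm x b, spdMetric_comm x b] at this
    linarith
  have tf : ∀ a b : Matrix (Fin r) (Fin r) ℝ, a.IsSymm → b.IsSymm →
      Γ x a b - spdChristoffel x a b = Γ x b a - spdChristoffel x b a := by
    intro a b ha hb
    rw [h.torsion_free x a b hx ha hb, h0.torsion_free x a b hx ha hb]
  have hs : (Γ x η ζ - spdChristoffel x η ζ).IsSymm :=
    (h.symm_valued x η ζ hx hη hζ).sub (h0.symm_valued x η ζ hx hη hζ)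
  refine sub_eq_zero.1 (eq_zero_of_spdMetric_self hx hs ?_)
  generalize hθ : Γ x η ζ - spdChristoffel x η ζ = θ at hs
  have e1 := key η ζ θ hη hζ hs
  have e2 := key θ η ζ hs hη hζ
  have e3 := key ζ θ η hζ hs hη
  rw [tf η θ hη hs] at e1
  rw [tf θ ζ hs hζ] at e2
  rw [tf ζ η hζ hη] at e3
  rw [hθ] at e1 e3
  linarith

end LeviCivita

/-- The covariant derivative `(D/dt) V` of a vector field `V` along a curve `γ` in `P(r)`. -/
noncomputable def spdCovDeriv {r : ℕ} (γ V : ℝ → Matrix (Fin r) (Fin r) ℝ) (t : ℝ) :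
    Matrix (Fin r) (Fin r) ℝ :=
  deriv V t + spdChristoffel (γ t) (deriv γ t) (V t)

/-- `γ` is a geodesic of `P(r)`.  The manifold is complete, so geodesics are parametrized by
the whole real line; they have constant, possibly zero, speed. -/
structure IsSpdGeodesic {r : ℕ} (γ : ℝ → Matrix (Fin r) (Fin r) ℝ) : Prop where
  posDef : ∀ t, (γ t).PosDef
  differentiable : Differentiable ℝ γ
  differentiable_deriv : Differentiable ℝ (deriv γ)
  covDeriv_eq_zero : ∀ t, spdCovDeriv γ (deriv γ) t = 0

/-- `V` is a parallel (tangent) vector field along the curve `γ` in `P(r)`. -/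
structure IsSpdParallel {r : ℕ} (γ V : ℝ → Matrix (Fin r) (Fin r) ℝ) : Prop where
  symm : ∀ t, (V t).IsSymm
  differentiable : Differentiable ℝ V
  covDeriv_eq_zero : ∀ t, spdCovDeriv γ V t = 0

/-- `P_t(ξ)`: the value at time `t` of the parallel field along `γ` that starts at `ξ`. -/
noncomputable def spdParallelTransport {r : ℕ} (γ : ℝ → Matrix (Fin r) (Fin r) ℝ)
    (ξ : Matrix (Fin r) (Fin r) ℝ) : ℝ → Matrix (Fin r) (Fin r) ℝ :=
  Classical.epsilon fun V => IsSpdParallel γ V ∧ V 0 = ξ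

/-- The square root `x^{1/2}` of a positive definite matrix. -/
noncomputable def spdSqrt {r : ℕ} (x : Matrix (Fin r) (Fin r) ℝ) : Matrix (Fin r) (Fin r) ℝ :=
  cfc Real.sqrt x

/-- The logarithm of a positive definite matrix. -/
noncomputable def spdLog {r : ℕ} (x : Matrix (Fin r) (Fin r) ℝ) : Matrix (Fin r) (Fin r) ℝ :=
  cfc Real.log x

/-- The geodesic distance `d(x, z) = ‖Log (x^{-1/2} z x^{-1/2})‖` (Frobenius norm). -/
noncomputable def spdDist {r : ℕ} (x z : Matrix (Fin r) (Fin r) ℝ) : ℝ :=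
  Real.sqrt (∑ i, ∑ j, (spdLog ((spdSqrt x)⁻¹ * z * (spdSqrt x)⁻¹)) i j ^ 2)

/-- The unit speed geodesic `γ` joining `x` and `z ≠ x`: `γ 0 = x` and `γ T = z` for the
geodesic distance `T` of `x` and `z`. -/
noncomputable def spdGeodesic {r : ℕ} (x z : Matrix (Fin r) (Fin r) ℝ) :
    ℝ → Matrix (Fin r) (Fin r) ℝ :=
  Classical.epsilon fun γ => IsSpdGeodesic γ ∧
    (∀ t, spdMetric (γ t) (deriv γ t) (deriv γ t) = 1) ∧ γ 0 = x ∧ γ (spdDist x z) = z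

/-- The midpoint `c(x, z)` of the geodesic joining `x` and `z` (here on the unit interval, which
also covers `x = z`). -/
noncomputable def spdMidpoint {r : ℕ} (x z : Matrix (Fin r) (Fin r) ℝ) :
    Matrix (Fin r) (Fin r) ℝ :=
  Classical.epsilon fun m => ∃ γ : ℝ → Matrix (Fin r) (Fin r) ℝ,
    IsSpdGeodesic γ ∧ γ 0 = x ∧ γ 1 = z ∧ γ (1 / 2) = m

/-- The tangent vector `ξ_ij` at `x` built from the vectors `v_1, …, v_r`:
`x^{1/2} (½ (v_i v_iᵀ + v_i v_iᵀ)) x^{1/2}` for `i = j` and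
`x^{1/2} ((1/√2) (v_i v_jᵀ + v_j v_iᵀ)) x^{1/2}` for `i ≠ j`. -/
noncomputable def spdFrame {r : ℕ} (x : Matrix (Fin r) (Fin r) ℝ)
    (v : Fin r → EuclideanSpace ℝ (Fin r)) (i j : Fin r) : Matrix (Fin r) (Fin r) ℝ :=
  spdSqrt x *
    ((if i = j then (1 / 2 : ℝ) else 1 / Real.sqrt 2) •
      (Matrix.vecMulVec (v i) (v j) + Matrix.vecMulVec (v j) (v i))) * spdSqrt x

/-! The midpoint map inverts an explicit quadratic map. Every geodesic satisfies `γ t * (γ (2 *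
t))⁻¹ * γ t = γ 0` (`IsSpdGeodesic.mul_inv_mul`), so the midpoint `m` of `y` and `z` solves `m z⁻¹ m
= y`; by uniqueness of positive square roots it is the only positive definite solution
(`eq_spdMidpoint`). Hence `c` is a right inverse of `Q m = m z⁻¹ m`, and `D_x c` is the inverse of
`DQ k = k z⁻¹ m + m z⁻¹ k`, a conjugated Sylvester operator, injective and therefore invertible
(`exists_hasFDerivWithinAt_spdMidpoint`).

It remains to apply `DQ` to `Ξ(T/2)`. With `s = x^{1/2}` the geodesic is `s exp(tL) s`, and the
parallel field from `s η s` is `s exp(tL/2) η exp(tL/2) s`. Since `m = γ(T/2)` and `z = γ(T)`, `DQ`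
sends `Ξ(T/2)` to `s (e^{TL/4} η e^{-TL/4} + e^{-TL/4} η e^{TL/4}) s`. For `η` proportional to `v_i
v_jᵀ + v_j v_iᵀ` this is `2 cosh(T(λ_i - λ_j)/4) ξ_ij`, and `1 / (2 cosh a) = sinh a / sinh 2a` for
`a ≠ 0`.

Geodesics and transport are chosen by `Classical.epsilon`, so both existence and uniqueness are
proved for them. -/

open scoped MatrixOrder Matrix.Norms.L2Operator

/-! ### Square roots, exponentials and logarithms -/

theorem spdSqrt_eq_sqrt {r : ℕ} {x : Matrix (Fin r) (Fin r) ℝ} (hx : x.PosDef) :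
    spdSqrt x = CFC.sqrt x := by
  rw [CFC.sqrt_eq_real_sqrt x hx.posSemidef.nonneg, cfcₙ_eq_cfc]
  rfl

theorem spdSqrt_mul_self {r : ℕ} {x : Matrix (Fin r) (Fin r) ℝ} (hx : x.PosDef) :
    spdSqrt x * spdSqrt x = x := by
  rw [spdSqrt_eq_sqrt hx, CFC.sqrt_mul_sqrt_self x hx.posSemidef.nonneg]

theorem posDef_spdSqrt {r : ℕ} {x : Matrix (Fin r) (Fin r) ℝ} (hx : x.PosDef) :
    (spdSqrt x).PosDef := by
  rw [spdSqrt_eq_sqrt hx]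
  exact (Matrix.isStrictlyPositive_iff_posDef.1
    (IsStrictlyPositive.sqrt x (Matrix.isStrictlyPositive_iff_posDef.2 hx)))

theorem Matrix.PosDef.isSymm_of_real {r : ℕ} {x : Matrix (Fin r) (Fin r) ℝ} (hx : x.PosDef) :
    x.IsSymm := by
  have h := hx.1.eq
  rwa [Matrix.conjTranspose_eq_transpose_of_trivial] at h

theorem Matrix.PosDef.mul_inv_self {r : ℕ} {x : Matrix (Fin r) (Fin r) ℝ} (hx : x.PosDef) :
    x * x⁻¹ = 1 :=
  Matrix.mul_nonsing_inv _ (x.isUnit_iff_isUnit_det.1 hx.isUnit)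

theorem Matrix.PosDef.inv_mul_self {r : ℕ} {x : Matrix (Fin r) (Fin r) ℝ} (hx : x.PosDef) :
    x⁻¹ * x = 1 :=
  Matrix.nonsing_inv_mul _ (x.isUnit_iff_isUnit_det.1 hx.isUnit)

theorem Matrix.PosDef.conj_posDef {r : ℕ} {s P : Matrix (Fin r) (Fin r) ℝ} (hs : s.PosDef)
    (hP : P.PosDef) : (s * P * s).PosDef := by
  have h := hP.conjTranspose_mul_mul_same (B := s) (Matrix.mulVec_injective_of_isUnit hs.isUnit)
  rwa [hs.1.eq] at h

theorem Matrix.IsSymm.posDef_exp {r : ℕ} {L : Matrix (Fin r) (Fin r) ℝ} (hL : L.IsSymm) :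
    (NormedSpace.exp L).PosDef := by
  have h : L.IsHermitian := by
    rw [Matrix.IsHermitian, Matrix.conjTranspose_eq_transpose_of_trivial]
    exact hL
  have h1 : (NormedSpace.exp L).PosSemidef := Matrix.nonneg_iff_posSemidef.1
    (IsSelfAdjoint.exp_nonneg h)
  exact h1.posDef_iff_isUnit.2 (Matrix.isUnit_exp L)

theorem exp_spdLog {r : ℕ} {x : Matrix (Fin r) (Fin r) ℝ} (hx : x.PosDef) :
    NormedSpace.exp (spdLog x) = x :=
  CFC.exp_log x hx.isStrictlyPositive

theorem isSymm_spdLog {r : ℕ} (x : Matrix (Fin r) (Fin r) ℝ) : (spdLog x).IsSymm := by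
  have h : IsSelfAdjoint (spdLog x) := cfc_predicate _ x
  have h2 : (spdLog x).conjTranspose = spdLog x := h
  rwa [Matrix.conjTranspose_eq_transpose_of_trivial] at h2

theorem exp_smul_mul_exp_smul {r : ℕ} (L : Matrix (Fin r) (Fin r) ℝ) (a b : ℝ) :
    NormedSpace.exp (a • L) * NormedSpace.exp (b • L) = NormedSpace.exp ((a + b) • L) := by
  rw [add_smul, Matrix.exp_add_of_commute]
  exact ((Commute.refl L).smul_left a).smul_right b

theorem exp_smul_mul_comm {r : ℕ} (L : Matrix (Fin r) (Fin r) ℝ) (a : ℝ) :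
    NormedSpace.exp (a • L) * L = L * NormedSpace.exp (a • L) :=
  ((hasDerivAt_exp_smul_const L a).unique (hasDerivAt_exp_smul_const' L a))

/-! ### Exponential curves are geodesics -/

/-- The curve `s exp (t L) s`. -/
noncomputable def expCurve {r : ℕ} (s L : Matrix (Fin r) (Fin r) ℝ) (t : ℝ) :
    Matrix (Fin r) (Fin r) ℝ :=
  s * NormedSpace.exp (t • L) * s

theorem hasDerivAt_mul_exp_smul_mul {r : ℕ} (a b L : Matrix (Fin r) (Fin r) ℝ) (t : ℝ) :
    HasDerivAt (fun t : ℝ => a * NormedSpace.exp (t • L) * b)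
      (a * (NormedSpace.exp (t • L) * L) * b) t :=
  ((hasDerivAt_exp_smul_const L t).const_mul a).mul_const b

theorem deriv_expCurve {r : ℕ} (s L : Matrix (Fin r) (Fin r) ℝ) :
    deriv (expCurve s L) = fun t => s * NormedSpace.exp (t • L) * (L * s) := by
  funext t
  have h : HasDerivAt (expCurve s L) (s * (NormedSpace.exp (t • L) * L) * s) t :=
    hasDerivAt_mul_exp_smul_mul s s L t
  rw [h.deriv]
  simp only [Matrix.mul_assoc]

theorem inv_expCurve {r : ℕ} {s : Matrix (Fin r) (Fin r) ℝ} (L : Matrix (Fin r) (Fin r) ℝ)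
    (hs : s.PosDef) (t : ℝ) :
    (expCurve s L t)⁻¹ = s⁻¹ * NormedSpace.exp ((-t) • L) * s⁻¹ := by
  refine Matrix.inv_eq_right_inv ?_
  have e : NormedSpace.exp (t • L) * NormedSpace.exp ((-t) • L) = 1 := by
    rw [exp_smul_mul_exp_smul]; simp
  calc s * NormedSpace.exp (t • L) * s * (s⁻¹ * NormedSpace.exp ((-t) • L) * s⁻¹)
      = s * NormedSpace.exp (t • L) * (s * s⁻¹) * NormedSpace.exp ((-t) • L) * s⁻¹ := by
        noncomm_ring
    _ = s * (NormedSpace.exp (t • L) * NormedSpace.exp ((-t) • L)) * s⁻¹ := by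
        rw [hs.mul_inv_self]; noncomm_ring
    _ = 1 := by rw [e, mul_one, hs.mul_inv_self]

/-- `γ⁻¹ γ'` is a conserved quantity; the geodesic equation, the speed and the coefficients of the
parallel equation all reduce to it. -/
theorem inv_mul_deriv_expCurve {r : ℕ} {s : Matrix (Fin r) (Fin r) ℝ}
    (L : Matrix (Fin r) (Fin r) ℝ) (hs : s.PosDef) (t : ℝ) :
    (expCurve s L t)⁻¹ * deriv (expCurve s L) t = s⁻¹ * L * s := by
  have e : NormedSpace.exp ((-t) • L) * NormedSpace.exp (t • L) = 1 := by
    rw [exp_smul_mul_exp_smul]; simp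
  rw [inv_expCurve L hs, deriv_expCurve]
  calc s⁻¹ * NormedSpace.exp ((-t) • L) * s⁻¹ * (s * NormedSpace.exp (t • L) * (L * s))
      = s⁻¹ * NormedSpace.exp ((-t) • L) * (s⁻¹ * s) * NormedSpace.exp (t • L) * L * s := by
        noncomm_ring
    _ = s⁻¹ * (NormedSpace.exp ((-t) • L) * NormedSpace.exp (t • L)) * L * s := by
        rw [hs.inv_mul_self]; noncomm_ring
    _ = _ := by rw [e, mul_one]

theorem isSpdGeodesic_expCurve {r : ℕ} {s L : Matrix (Fin r) (Fin r) ℝ} (hs : s.PosDef)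
    (hL : L.IsSymm) : IsSpdGeodesic (expCurve s L) where
  posDef t := hs.conj_posDef (hL.smul t).posDef_exp
  differentiable t := (hasDerivAt_mul_exp_smul_mul s s L t).differentiableAt
  differentiable_deriv t := by
    rw [deriv_expCurve]
    exact (hasDerivAt_mul_exp_smul_mul s (L * s) L t).differentiableAt
  covDeriv_eq_zero t := by
    have h2 : deriv (deriv (expCurve s L)) t = s * NormedSpace.exp (t • L) * L * L * s := by
      rw [deriv_expCurve, (hasDerivAt_mul_exp_smul_mul s (L * s) L t).deriv]
      simp only [Matrix.mul_assoc]
    have h3 : deriv (expCurve s L) t * (expCurve s L t)⁻¹ * deriv (expCurve s L) t =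
        s * NormedSpace.exp (t • L) * L * L * s := by
      rw [Matrix.mul_assoc, inv_mul_deriv_expCurve L hs, deriv_expCurve]
      calc s * NormedSpace.exp (t • L) * (L * s) * (s⁻¹ * L * s)
          = s * NormedSpace.exp (t • L) * L * (s * s⁻¹) * L * s := by noncomm_ring
        _ = _ := by rw [hs.mul_inv_self, mul_one]
    rw [spdCovDeriv, spdChristoffel, h2, h3, ← two_smul ℝ, smul_smul]
    norm_num

theorem spdMetric_expCurve {r : ℕ} {s : Matrix (Fin r) (Fin r) ℝ}
    (L : Matrix (Fin r) (Fin r) ℝ) (hs : s.PosDef) (t : ℝ) :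
    spdMetric (expCurve s L t) (deriv (expCurve s L) t) (deriv (expCurve s L) t) =
      (L * L).trace := by
  rw [spdMetric, Matrix.mul_assoc (_ * _), Matrix.mul_assoc, Matrix.trace_mul_comm,
    ← Matrix.mul_assoc, Matrix.mul_assoc, Matrix.mul_assoc, inv_mul_deriv_expCurve L hs,
    ← Matrix.mul_assoc, inv_mul_deriv_expCurve L hs]
  have : s⁻¹ * L * s * (s⁻¹ * L * s) = s⁻¹ * (L * (s * s⁻¹) * L * s) := by noncomm_ring
  rw [this, Matrix.trace_mul_comm, hs.mul_inv_self, mul_one, Matrix.mul_assoc, hs.mul_inv_self,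
    mul_one]

theorem Matrix.IsSymm.trace_mul_self_eq_sum {r : ℕ} {L : Matrix (Fin r) (Fin r) ℝ}
    (hL : L.IsSymm) : (L * L).trace = ∑ i, ∑ j, L i j ^ 2 := by
  simp only [Matrix.trace, Matrix.diag, Matrix.mul_apply]
  refine Finset.sum_congr rfl fun i _ => Finset.sum_congr rfl fun j _ => ?_
  rw [hL.apply i j, sq]

/-! ### Existence of geodesics -/

theorem posDef_inv_spdSqrt_conj {r : ℕ} {x z : Matrix (Fin r) (Fin r) ℝ} (hx : x.PosDef)
    (hz : z.PosDef) : ((spdSqrt x)⁻¹ * z * (spdSqrt x)⁻¹).PosDef :=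
  (posDef_spdSqrt hx).inv.conj_posDef hz

theorem spdSqrt_mul_exp_spdLog_mul {r : ℕ} {x z : Matrix (Fin r) (Fin r) ℝ} (hx : x.PosDef)
    (hz : z.PosDef) : spdSqrt x *
      NormedSpace.exp (spdLog ((spdSqrt x)⁻¹ * z * (spdSqrt x)⁻¹)) * spdSqrt x = z := by
  rw [exp_spdLog (posDef_inv_spdSqrt_conj hx hz)]
  have hs := posDef_spdSqrt hx
  calc spdSqrt x * ((spdSqrt x)⁻¹ * z * (spdSqrt x)⁻¹) * spdSqrt x
      = (spdSqrt x * (spdSqrt x)⁻¹) * z * ((spdSqrt x)⁻¹ * spdSqrt x) := by noncomm_ring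
    _ = z := by rw [hs.mul_inv_self, hs.inv_mul_self, one_mul, mul_one]

theorem spdDist_ne_zero {r : ℕ} {x z : Matrix (Fin r) (Fin r) ℝ} (hx : x.PosDef)
    (hz : z.PosDef) (hxz : x ≠ z) : spdDist x z ≠ 0 := by
  intro h
  apply hxz
  have h1 : spdLog ((spdSqrt x)⁻¹ * z * (spdSqrt x)⁻¹) = 0 := by
    rw [spdDist, Real.sqrt_eq_zero (by positivity)] at h
    rw [Finset.sum_eq_zero_iff_of_nonneg (fun i _ => by positivity)] at h
    ext i j
    have h2 := h i (Finset.mem_univ i)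
    rw [Finset.sum_eq_zero_iff_of_nonneg (fun i _ => by positivity)] at h2
    simpa using h2 j (Finset.mem_univ j)
  have h3 := spdSqrt_mul_exp_spdLog_mul hx hz
  rw [h1, NormedSpace.exp_zero, mul_one, spdSqrt_mul_self hx] at h3
  exact h3

theorem exists_geodesic {r : ℕ} {x z : Matrix (Fin r) (Fin r) ℝ} (hx : x.PosDef)
    (hz : z.PosDef) : ∃ γ, IsSpdGeodesic γ ∧ γ 0 = x ∧ γ 1 = z := by
  refine ⟨_, isSpdGeodesic_expCurve (posDef_spdSqrt hx)
    (isSymm_spdLog ((spdSqrt x)⁻¹ * z * (spdSqrt x)⁻¹)), ?_, ?_⟩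
  · simp [expCurve, spdSqrt_mul_self hx]
  · simp [expCurve, spdSqrt_mul_exp_spdLog_mul hx hz]

theorem exists_unit_speed_geodesic {r : ℕ} {x z : Matrix (Fin r) (Fin r) ℝ} (hx : x.PosDef)
    (hz : z.PosDef) (hxz : x ≠ z) : ∃ γ, IsSpdGeodesic γ ∧
      (∀ t, spdMetric (γ t) (deriv γ t) (deriv γ t) = 1) ∧ γ 0 = x ∧ γ (spdDist x z) = z := by
  have hT := spdDist_ne_zero hx hz hxz
  have hL := isSymm_spdLog ((spdSqrt x)⁻¹ * z * (spdSqrt x)⁻¹)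
  -- The squared speed is `tr (L * L)`, and `spdDist x z` is the Frobenius norm of the logarithm, so
  -- dividing by it gives unit speed.
  refine ⟨expCurve (spdSqrt x)
    ((spdDist x z)⁻¹ • spdLog ((spdSqrt x)⁻¹ * z * (spdSqrt x)⁻¹)),
    isSpdGeodesic_expCurve (posDef_spdSqrt hx) (hL.smul _), fun t => ?_, ?_, ?_⟩
  · rw [spdMetric_expCurve _ (posDef_spdSqrt hx), smul_mul_smul_comm, Matrix.trace_smul,
      hL.trace_mul_self_eq_sum]
    have h2 : spdDist x z ^ 2 =
        ∑ i, ∑ j, (spdLog ((spdSqrt x)⁻¹ * z * (spdSqrt x)⁻¹)) i j ^ 2 :=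
      Real.sq_sqrt (by positivity)
    rw [← h2, smul_eq_mul]
    field_simp
  · simp [expCurve, spdSqrt_mul_self hx]
  · rw [expCurve, smul_inv_smul₀ hT, spdSqrt_mul_exp_spdLog_mul hx hz]

theorem spdGeodesic_spec {r : ℕ} {x z : Matrix (Fin r) (Fin r) ℝ} (hx : x.PosDef)
    (hz : z.PosDef) (hxz : x ≠ z) : IsSpdGeodesic (spdGeodesic x z) ∧
      (∀ t, spdMetric (spdGeodesic x z t) (deriv (spdGeodesic x z) t)
        (deriv (spdGeodesic x z) t) = 1) ∧
      spdGeodesic x z 0 = x ∧ spdGeodesic x z (spdDist x z) = z :=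
  Classical.epsilon_spec (exists_unit_speed_geodesic hx hz hxz)

/-! ### Uniqueness of geodesics -/

theorem HasDerivAt.matrix_inv {r : ℕ} {γ : ℝ → Matrix (Fin r) (Fin r) ℝ}
    {γ' : Matrix (Fin r) (Fin r) ℝ} {t : ℝ} (h : HasDerivAt γ γ' t) (hu : IsUnit (γ t)) :
    HasDerivAt (fun t => (γ t)⁻¹) (-((γ t)⁻¹ * γ' * (γ t)⁻¹)) t := by
  obtain ⟨u, hu⟩ := hu
  have h4 := HasFDerivAt.comp_hasDerivAt_of_eq t (hasFDerivAt_ringInverse (𝕜 := ℝ) u) h hu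
  simp only [Function.comp_def, ← Matrix.nonsing_inv_eq_ringInverse] at h4
  rw [← hu]
  refine h4.congr_deriv ?_
  simp

theorem IsSpdGeodesic.deriv_deriv {r : ℕ} {γ : ℝ → Matrix (Fin r) (Fin r) ℝ}
    (h : IsSpdGeodesic γ) (t : ℝ) :
    deriv (deriv γ) t = deriv γ t * (γ t)⁻¹ * deriv γ t := by
  have h1 := h.covDeriv_eq_zero t
  rw [spdCovDeriv, spdChristoffel, ← two_smul ℝ, smul_smul] at h1
  norm_num at h1
  rwa [← sub_eq_add_neg, sub_eq_zero] at h1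

/-- The geodesic equation `γ'' = γ' γ⁻¹ γ'` says exactly that `γ⁻¹ γ'` has zero derivative. -/
theorem IsSpdGeodesic.deriv_eq {r : ℕ} {γ : ℝ → Matrix (Fin r) (Fin r) ℝ}
    (h : IsSpdGeodesic γ) (t : ℝ) : deriv γ t = γ t * ((γ 0)⁻¹ * deriv γ 0) := by
  have hd : ∀ t, HasDerivAt (fun t => (γ t)⁻¹ * deriv γ t) 0 t := fun t => by
    refine (((h.differentiable t).hasDerivAt.matrix_inv (h.posDef t).isUnit).mul
      (h.differentiable_deriv t).hasDerivAt).congr_deriv ?_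
    rw [h.deriv_deriv]
    noncomm_ring
  have := is_const_of_deriv_eq_zero (fun t => (hd t).differentiableAt) (fun t => (hd t).deriv) t 0
  rw [← this, ← Matrix.mul_assoc, (h.posDef t).mul_inv_self, one_mul]

/-- With `A = γ(0)⁻¹ γ'(0)` the equation is linear, `γ' = γ A`, so `γ(t) exp(-tA)` is constant. -/
theorem IsSpdGeodesic.eq_mul_exp {r : ℕ} {γ : ℝ → Matrix (Fin r) (Fin r) ℝ}
    (h : IsSpdGeodesic γ) (t : ℝ) :
    γ t = γ 0 * NormedSpace.exp (t • ((γ 0)⁻¹ * deriv γ 0)) := by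
  have h1 := h.deriv_eq
  generalize (γ 0)⁻¹ * deriv γ 0 = A at h1
  have hd : ∀ t, HasDerivAt (fun t => γ t * NormedSpace.exp (t • -A)) 0 t := fun t => by
    refine ((h.differentiable t).hasDerivAt.mul (hasDerivAt_exp_smul_const' (-A) t)).congr_deriv ?_
    rw [h1 t]
    noncomm_ring
  have := is_const_of_deriv_eq_zero (fun t => (hd t).differentiableAt) (fun t => (hd t).deriv) t 0
  simp only [zero_smul, NormedSpace.exp_zero, mul_one] at this
  rw [← this, Matrix.mul_assoc, smul_neg, ← neg_smul, exp_smul_mul_exp_smul]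
  simp

theorem IsSpdGeodesic.eq_expCurve {r : ℕ} {γ : ℝ → Matrix (Fin r) (Fin r) ℝ}
    (h : IsSpdGeodesic γ) :
    γ = expCurve (spdSqrt (γ 0)) ((spdSqrt (γ 0))⁻¹ * deriv γ 0 * (spdSqrt (γ 0))⁻¹) := by
  funext t
  rw [h.eq_mul_exp t]
  have hs := posDef_spdSqrt (h.posDef 0)
  have hss := spdSqrt_mul_self (h.posDef 0)
  generalize spdSqrt (γ 0) = s at hs hss
  have e : t • ((γ 0)⁻¹ * deriv γ 0) = s⁻¹ * (t • (s⁻¹ * deriv γ 0 * s⁻¹)) * s := by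
    rw [← hss, Matrix.mul_inv_rev, mul_smul_comm, smul_mul_assoc]
    congr 1
    calc s⁻¹ * s⁻¹ * deriv γ 0 = s⁻¹ * s⁻¹ * deriv γ 0 * (s⁻¹ * s) := by
          rw [hs.inv_mul_self, mul_one]
      _ = _ := by noncomm_ring
  rw [e, Matrix.exp_conj' _ _ hs.isUnit, expCurve]
  conv_lhs => rw [← hss]
  calc _ = s * (s * s⁻¹) * NormedSpace.exp (t • (s⁻¹ * deriv γ 0 * s⁻¹)) * s := by noncomm_ring
    _ = _ := by rw [hs.mul_inv_self, mul_one]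

/-! ### Parallel transport -/

/-- The field `s exp (t L / 2) η exp (t L / 2) s` along the curve `s exp (t L) s`. -/
noncomputable def expField {r : ℕ} (s L η : Matrix (Fin r) (Fin r) ℝ) (t : ℝ) :
    Matrix (Fin r) (Fin r) ℝ :=
  s * NormedSpace.exp ((t / 2) • L) * η * (NormedSpace.exp ((t / 2) • L) * s)

theorem spdCovDeriv_expCurve {r : ℕ} {s L : Matrix (Fin r) (Fin r) ℝ} (hs : s.PosDef)
    (V : ℝ → Matrix (Fin r) (Fin r) ℝ) (t : ℝ) :
    spdCovDeriv (expCurve s L) V t =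
      deriv V t - (1 / 2 : ℝ) • (s * L * s⁻¹ * V t + V t * (s⁻¹ * L * s)) := by
  have h : deriv (expCurve s L) t * (expCurve s L t)⁻¹ = s * L * s⁻¹ := by
    have e : NormedSpace.exp (t • L) * NormedSpace.exp ((-t) • L) = 1 := by
      rw [exp_smul_mul_exp_smul]; simp
    rw [deriv_expCurve, inv_expCurve L hs]
    calc s * NormedSpace.exp (t • L) * (L * s) * (s⁻¹ * NormedSpace.exp ((-t) • L) * s⁻¹)
        = s * (NormedSpace.exp (t • L) * L) * (s * s⁻¹) * NormedSpace.exp ((-t) • L) * s⁻¹ := by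
          noncomm_ring
      _ = s * L * (NormedSpace.exp (t • L) * NormedSpace.exp ((-t) • L)) * s⁻¹ := by
          rw [hs.mul_inv_self, exp_smul_mul_comm]; noncomm_ring
      _ = _ := by rw [e, mul_one]
  rw [spdCovDeriv, spdChristoffel, h, Matrix.mul_assoc (V t), inv_mul_deriv_expCurve L hs,
    sub_eq_add_neg]

theorem hasDerivAt_exp_half {r : ℕ} (L : Matrix (Fin r) (Fin r) ℝ) (t : ℝ) :
    HasDerivAt (fun t : ℝ => NormedSpace.exp ((t / 2) • L))
      ((1 / 2 : ℝ) • (NormedSpace.exp ((t / 2) • L) * L)) t :=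
  HasDerivAt.scomp (g₁ := fun u : ℝ => NormedSpace.exp (u • L)) t
    (hasDerivAt_exp_smul_const L (t / 2)) ((hasDerivAt_id t).div_const 2)

theorem isSpdParallel_expField {r : ℕ} {s L η : Matrix (Fin r) (Fin r) ℝ} (hs : s.PosDef)
    (hL : L.IsSymm) (hη : η.IsSymm) : IsSpdParallel (expCurve s L) (expField s L η) := by
  have hd : ∀ t, HasDerivAt (expField s L η) ((1 / 2 : ℝ) •
      (s * L * s⁻¹ * expField s L η t + expField s L η t * (s⁻¹ * L * s))) t := fun t => by
    refine ((((hasDerivAt_exp_half L t).const_mul s).mul_const η).mul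
      ((hasDerivAt_exp_half L t).mul_const s)).congr_deriv ?_
    have e1 : s * L * s⁻¹ * expField s L η t =
        s * (NormedSpace.exp ((t / 2) • L) * L) * η * (NormedSpace.exp ((t / 2) • L) * s) := by
      rw [exp_smul_mul_comm, expField]
      calc _ = s * L * (s⁻¹ * s) * NormedSpace.exp ((t / 2) • L) * η *
            (NormedSpace.exp ((t / 2) • L) * s) := by noncomm_ring
        _ = _ := by rw [hs.inv_mul_self, mul_one]; noncomm_ring
    have e2 : expField s L η t * (s⁻¹ * L * s) =
        s * NormedSpace.exp ((t / 2) • L) * η * (NormedSpace.exp ((t / 2) • L) * L * s) := by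
      rw [expField]
      calc _ = s * NormedSpace.exp ((t / 2) • L) * η *
            (NormedSpace.exp ((t / 2) • L) * (s * s⁻¹) * L * s) := by noncomm_ring
        _ = _ := by rw [hs.mul_inv_self, mul_one]
    rw [e1, e2, smul_add]
    simp only [mul_smul_comm, smul_mul_assoc]
  refine ⟨fun t => ?_, fun t => (hd t).differentiableAt, fun t => ?_⟩
  · have h1 := ((hL.smul (t / 2)).posDef_exp).isSymm_of_real
    have h2 := hs.isSymm_of_real
    unfold Matrix.IsSymm at *
    simp only [expField, Matrix.transpose_mul, h1, h2, hη, Matrix.mul_assoc]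
  · rw [spdCovDeriv_expCurve hs, (hd t).deriv, sub_self]

/-- The parallel equation has constant coefficients here: undoing the transport, `exp(-tL/2) s⁻¹ V
s⁻¹ exp(-tL/2)` has zero derivative and stays equal to `η`. -/
theorem IsSpdParallel.eq_expField {r : ℕ} {s L η : Matrix (Fin r) (Fin r) ℝ} (hs : s.PosDef)
    {V : ℝ → Matrix (Fin r) (Fin r) ℝ} (hV : IsSpdParallel (expCurve s L) V)
    (h0 : V 0 = s * η * s) : V = expField s L η := by
  have hV' : ∀ t, deriv V t = (1 / 2 : ℝ) • (s * L * s⁻¹ * V t + V t * (s⁻¹ * L * s)) :=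
    fun t => by
      have h := hV.covDeriv_eq_zero t
      rwa [spdCovDeriv_expCurve hs, sub_eq_zero] at h
  have hd : ∀ t, HasDerivAt (fun t : ℝ => NormedSpace.exp ((t / 2) • -L) * s⁻¹ * V t *
      (s⁻¹ * NormedSpace.exp ((t / 2) • -L))) 0 t := fun t => by
    refine ((((hasDerivAt_exp_half (-L) t).mul_const s⁻¹).mul (hV.differentiable t).hasDerivAt).mul
      ((hasDerivAt_exp_half (-L) t).const_mul s⁻¹)).congr_deriv ?_
    have e : NormedSpace.exp ((t / 2) • -L) * L = L * NormedSpace.exp ((t / 2) • -L) := by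
      have := exp_smul_mul_comm (-L) (t / 2)
      simpa using this
    rw [hV' t]
    simp only [Pi.mul_apply]
    generalize NormedSpace.exp ((t / 2) • -L) = E at e ⊢
    have e1 : E * s⁻¹ * (s * L * s⁻¹ * V t + V t * (s⁻¹ * L * s)) * (s⁻¹ * E) =
        E * L * s⁻¹ * V t * (s⁻¹ * E) + E * s⁻¹ * V t * (s⁻¹ * (E * L)) := by
      calc _ = E * (s⁻¹ * s) * L * s⁻¹ * V t * (s⁻¹ * E) +
            E * s⁻¹ * V t * (s⁻¹ * (L * (s * s⁻¹) * E)) := by noncomm_ring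
        _ = _ := by rw [hs.inv_mul_self, hs.mul_inv_self, mul_one, mul_one, e]
    simp only [mul_smul_comm, smul_mul_assoc, ← smul_add, add_mul, e1]
    refine smul_eq_zero_of_right _ ?_
    noncomm_ring
  funext t
  have h := is_const_of_deriv_eq_zero (fun t => (hd t).differentiableAt) (fun t => (hd t).deriv) t 0
  simp only [zero_div, zero_smul, NormedSpace.exp_zero, one_mul, mul_one, h0] at h
  have e1 : s⁻¹ * (s * η * s) * s⁻¹ = η := by
    calc _ = (s⁻¹ * s) * η * (s * s⁻¹) := by noncomm_ring
      _ = η := by rw [hs.inv_mul_self, hs.mul_inv_self, one_mul, mul_one]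
  have e2 : NormedSpace.exp ((t / 2) • L) * NormedSpace.exp ((t / 2) • -L) = 1 := by
    rw [smul_neg, ← neg_smul, exp_smul_mul_exp_smul]; simp
  have e3 : NormedSpace.exp ((t / 2) • -L) * NormedSpace.exp ((t / 2) • L) = 1 := by
    rw [smul_neg, ← neg_smul, exp_smul_mul_exp_smul]; simp
  rw [expField, ← e1, ← h]
  generalize NormedSpace.exp ((t / 2) • -L) = F at *
  generalize NormedSpace.exp ((t / 2) • L) = E at *
  symm
  calc _ = s * (E * F) * s⁻¹ * V t * (s⁻¹ * (F * E) * s) := by noncomm_ring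
    _ = V t := by
      rw [e2, e3, mul_one, mul_one, hs.mul_inv_self, hs.inv_mul_self, one_mul, mul_one]

theorem spdParallelTransport_expCurve {r : ℕ} {s L η : Matrix (Fin r) (Fin r) ℝ} (hs : s.PosDef)
    (hL : L.IsSymm) (hη : η.IsSymm) :
    spdParallelTransport (expCurve s L) (s * η * s) = expField s L η := by
  have h : IsSpdParallel (expCurve s L) (spdParallelTransport (expCurve s L) (s * η * s)) ∧
      spdParallelTransport (expCurve s L) (s * η * s) 0 = s * η * s :=
    Classical.epsilon_spec (p := fun V => IsSpdParallel (expCurve s L) V ∧ V 0 = s * η * s)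
      ⟨_, isSpdParallel_expField hs hL hη, by simp [expField, Matrix.mul_assoc]⟩
  exact h.1.eq_expField hs h.2

/-! ### The quadratic equation of the midpoint -/

theorem expCurve_mul_inv_mul {r : ℕ} {s : Matrix (Fin r) (Fin r) ℝ}
    (L : Matrix (Fin r) (Fin r) ℝ) (hs : s.PosDef) (t : ℝ) :
    expCurve s L t * (expCurve s L (2 * t))⁻¹ = s * NormedSpace.exp ((-t) • L) * s⁻¹ ∧
      (expCurve s L (2 * t))⁻¹ * expCurve s L t = s⁻¹ * NormedSpace.exp ((-t) • L) * s := by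
  have e1 : NormedSpace.exp (t • L) * NormedSpace.exp ((-(2 * t)) • L) =
      NormedSpace.exp ((-t) • L) := by
    rw [exp_smul_mul_exp_smul]; ring_nf
  have e2 : NormedSpace.exp ((-(2 * t)) • L) * NormedSpace.exp (t • L) =
      NormedSpace.exp ((-t) • L) := by
    rw [exp_smul_mul_exp_smul]; ring_nf
  rw [inv_expCurve L hs, expCurve]
  constructor
  · calc _ = s * NormedSpace.exp (t • L) * (s * s⁻¹) * NormedSpace.exp ((-(2 * t)) • L) * s⁻¹ := by
          noncomm_ring
      _ = s * (NormedSpace.exp (t • L) * NormedSpace.exp ((-(2 * t)) • L)) * s⁻¹ := by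
          rw [hs.mul_inv_self]; noncomm_ring
      _ = _ := by rw [e1]
  · calc _ = s⁻¹ * NormedSpace.exp ((-(2 * t)) • L) * (s⁻¹ * s) * NormedSpace.exp (t • L) * s := by
          noncomm_ring
      _ = s⁻¹ * (NormedSpace.exp ((-(2 * t)) • L) * NormedSpace.exp (t • L)) * s := by
          rw [hs.inv_mul_self]; noncomm_ring
      _ = _ := by rw [e2]

theorem IsSpdGeodesic.mul_inv_mul {r : ℕ} {γ : ℝ → Matrix (Fin r) (Fin r) ℝ}
    (h : IsSpdGeodesic γ) (t : ℝ) : γ t * (γ (2 * t))⁻¹ * γ t = γ 0 := by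
  have hs := posDef_spdSqrt (h.posDef 0)
  have hss := spdSqrt_mul_self (h.posDef 0)
  rw [← hss]
  have e := h.eq_expCurve
  generalize (spdSqrt (γ 0))⁻¹ * deriv γ 0 * (spdSqrt (γ 0))⁻¹ = L at e
  generalize spdSqrt (γ 0) = s at *
  rw [e, (expCurve_mul_inv_mul L hs t).1, expCurve]
  have e1 : NormedSpace.exp ((-t) • L) * NormedSpace.exp (t • L) = 1 := by
    rw [exp_smul_mul_exp_smul]; simp
  calc _ = s * NormedSpace.exp ((-t) • L) * (s⁻¹ * s) * NormedSpace.exp (t • L) * s := by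
        noncomm_ring
    _ = s * (NormedSpace.exp ((-t) • L) * NormedSpace.exp (t • L)) * s := by
        rw [hs.inv_mul_self]; noncomm_ring
    _ = _ := by rw [e1, mul_one]

theorem spdMidpoint_spec {r : ℕ} {y z : Matrix (Fin r) (Fin r) ℝ} (hy : y.PosDef)
    (hz : z.PosDef) :
    (spdMidpoint y z).PosDef ∧ spdMidpoint y z * z⁻¹ * spdMidpoint y z = y := by
  obtain ⟨γ₀, h₀, h₀0, h₀1⟩ := exists_geodesic hy hz
  obtain ⟨γ, h, rfl, rfl, hm⟩ : ∃ γ : ℝ → Matrix (Fin r) (Fin r) ℝ,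
      IsSpdGeodesic γ ∧ γ 0 = y ∧ γ 1 = z ∧ γ (1 / 2) = spdMidpoint y z :=
    Classical.epsilon_spec (p := fun m => ∃ γ : ℝ → Matrix (Fin r) (Fin r) ℝ,
      IsSpdGeodesic γ ∧ γ 0 = y ∧ γ 1 = z ∧ γ (1 / 2) = m) ⟨_, γ₀, h₀, h₀0, h₀1, rfl⟩
  rw [← hm]
  refine ⟨h.posDef _, ?_⟩
  have := h.mul_inv_mul (1 / 2)
  norm_num at this ⊢
  exact this

/-- Conjugation by `z^{-1/2}` turns the equation into `(z^{-1/2} m z^{-1/2})² = z^{-1/2} y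
z^{-1/2}`, which has one nonnegative root. -/
theorem eq_spdSqrt_mul_sqrt_mul {r : ℕ} {y z m : Matrix (Fin r) (Fin r) ℝ} (hz : z.PosDef)
    (hm : m.PosDef) (h : m * z⁻¹ * m = y) :
    m = spdSqrt z * CFC.sqrt ((spdSqrt z)⁻¹ * y * (spdSqrt z)⁻¹) * spdSqrt z := by
  have hs := posDef_spdSqrt hz
  have hss := spdSqrt_mul_self hz
  generalize spdSqrt z = s at *
  have h1 : CFC.sqrt (s⁻¹ * y * s⁻¹) = s⁻¹ * m * s⁻¹ := by
    refine CFC.sqrt_unique ?_ (hs.inv.conj_posDef hm).posSemidef.nonneg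
    rw [← h, ← hss, Matrix.mul_inv_rev]
    noncomm_ring
  rw [h1]
  calc m = (s * s⁻¹) * m * (s⁻¹ * s) := by
        rw [hs.inv_mul_self, hs.mul_inv_self, one_mul, mul_one]
    _ = _ := by noncomm_ring

theorem eq_spdMidpoint {r : ℕ} {y z m : Matrix (Fin r) (Fin r) ℝ} (hy : y.PosDef)
    (hz : z.PosDef) (hm : m.PosDef) (h : m * z⁻¹ * m = y) : spdMidpoint y z = m := by
  have h1 := spdMidpoint_spec hy hz
  rw [eq_spdSqrt_mul_sqrt_mul hz hm h]
  exact eq_spdSqrt_mul_sqrt_mul hz h1.1 h1.2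

/-- Needed to identify `c` with the local inverse of `Q`, which only controls solutions close to
`m`. -/
theorem continuousOn_spdMidpoint {r : ℕ} {z : Matrix (Fin r) (Fin r) ℝ} (hz : z.PosDef) :
    ContinuousOn (fun y => spdMidpoint y z) {y | y.PosDef} := by
  have h1 : ContinuousOn (fun y => CFC.sqrt ((spdSqrt z)⁻¹ * y * (spdSqrt z)⁻¹)) {y | y.PosDef} :=
    CFC.continuousOn_sqrt.comp (by fun_prop) fun y hy =>
      ((posDef_spdSqrt hz).inv.conj_posDef hy).posSemidef.nonneg
  refine ((continuousOn_const (c := spdSqrt z)).mul h1 |>.mul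
    (continuousOn_const (c := spdSqrt z))).congr fun y hy => ?_
  have h2 := spdMidpoint_spec hy hz
  exact eq_spdSqrt_mul_sqrt_mul hz h2.1 h2.2

/-! ### Differentiability of the midpoint map -/

/-- The Sylvester operator of a positive definite matrix is injective. -/
theorem Matrix.PosDef.eq_zero_of_sylvester {r : ℕ} {P k : Matrix (Fin r) (Fin r) ℝ}
    (hP : P.PosDef) (h : k * P + P * k = 0) : k = 0 := by
  have hs := posDef_spdSqrt hP
  have hss := spdSqrt_mul_self hP
  generalize spdSqrt P = B at *
  have hB : B.transpose = B := hs.isSymm_of_real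
  -- Pair the equation with `kᵀ`: `tr(kᵀPk) + tr(kᵀkP) = 0`, and with `P = B²` both terms are
  -- squared Frobenius norms.
  have h1 : ((B * k).conjTranspose * (B * k)).trace + ((k * B).conjTranspose * (k * B)).trace
      = 0 := by
    simp only [Matrix.conjTranspose_eq_transpose_of_trivial, Matrix.transpose_mul, hB]
    have e1 : (k.transpose * B * (B * k)).trace = (k.transpose * (P * k)).trace := by
      rw [← hss]; congr 1; noncomm_ring
    have e2 : (B * k.transpose * (k * B)).trace = (k.transpose * (k * P)).trace := by
      rw [← hss, Matrix.mul_assoc, Matrix.trace_mul_comm]; congr 1; noncomm_ring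
    rw [e1, e2, ← Matrix.trace_add, ← mul_add, add_comm, h]
    simp
  have h2 := (Matrix.posSemidef_conjTranspose_mul_self (B * k)).trace_nonneg
  have h3 := (Matrix.posSemidef_conjTranspose_mul_self (k * B)).trace_nonneg
  have h4 : ((B * k).conjTranspose * (B * k)).trace = 0 := by linarith
  rw [Matrix.trace_conjTranspose_mul_self_eq_zero_iff] at h4
  exact hs.isUnit.mul_right_eq_zero.1 h4

theorem eq_zero_of_mul_inv_mul {r : ℕ} {z m k : Matrix (Fin r) (Fin r) ℝ} (hz : z.PosDef)
    (hm : m.PosDef) (h : k * (z⁻¹ * m) + m * z⁻¹ * k = 0) : k = 0 := by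
  have hs := posDef_spdSqrt hm
  have hss := spdSqrt_mul_self hm
  generalize spdSqrt m = s at *
  -- Conjugation by `m^{-1/2}` gives a Sylvester equation with `P = m^{1/2} z⁻¹ m^{1/2}`.
  have h1 : s⁻¹ * k * s⁻¹ = 0 := by
    refine (hs.conj_posDef hz.inv).eq_zero_of_sylvester ?_
    calc _ = s⁻¹ * k * (s⁻¹ * s) * z⁻¹ * s + s * z⁻¹ * (s * s⁻¹) * k * s⁻¹ := by noncomm_ring
      _ = s⁻¹ * k * z⁻¹ * s * (s * s⁻¹) + (s⁻¹ * s) * s * z⁻¹ * k * s⁻¹ := by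
        rw [hs.inv_mul_self, hs.mul_inv_self, mul_one, mul_one, mul_one, one_mul]
      _ = s⁻¹ * (k * (z⁻¹ * m) + m * z⁻¹ * k) * s⁻¹ := by rw [← hss]; noncomm_ring
      _ = 0 := by rw [h]; simp
  calc k = (s * s⁻¹) * k * (s⁻¹ * s) := by
        rw [hs.inv_mul_self, hs.mul_inv_self, one_mul, mul_one]
    _ = s * (s⁻¹ * k * s⁻¹) * s := by noncomm_ring
    _ = 0 := by rw [h1]; simp

/-- The differential of `m ↦ m z⁻¹ m`. -/
noncomputable def quadDeriv {r : ℕ} (z m : Matrix (Fin r) (Fin r) ℝ) :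
    Matrix (Fin r) (Fin r) ℝ →L[ℝ] Matrix (Fin r) (Fin r) ℝ :=
  (ContinuousLinearMap.mul ℝ _).flip (z⁻¹ * m) + ContinuousLinearMap.mul ℝ _ (m * z⁻¹)

theorem quadDeriv_apply {r : ℕ} (z m k : Matrix (Fin r) (Fin r) ℝ) :
    quadDeriv z m k = k * (z⁻¹ * m) + m * z⁻¹ * k := rfl

theorem hasStrictFDerivAt_quad {r : ℕ} (z m : Matrix (Fin r) (Fin r) ℝ) :
    HasStrictFDerivAt (fun m => m * z⁻¹ * m) (quadDeriv z m) m := by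
  refine (((hasStrictFDerivAt_id (𝕜 := ℝ) m).mul_const' z⁻¹).mul'
    (hasStrictFDerivAt_id m)).congr_fderiv ?_
  ext1 k
  simp [quadDeriv_apply, Matrix.mul_assoc, add_comm]

/-- Inverse function theorem for `Q` on the space of all matrices. The derivative is taken within
the positive definite matrices, where the midpoint equation is available. -/
theorem exists_hasFDerivWithinAt_spdMidpoint {r : ℕ} {x z : Matrix (Fin r) (Fin r) ℝ}
    (hx : x.PosDef) (hz : z.PosDef) :
    ∃ D : Matrix (Fin r) (Fin r) ℝ →L[ℝ] Matrix (Fin r) (Fin r) ℝ,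
      HasFDerivWithinAt (fun y => spdMidpoint y z) D {y | y.PosDef} x ∧
      ∀ k, D (k * (z⁻¹ * spdMidpoint x z) + spdMidpoint x z * z⁻¹ * k) = k := by
  obtain ⟨hm, hmx⟩ := spdMidpoint_spec hx hz
  have hc := continuousOn_spdMidpoint hz x hx
  generalize hm0 : spdMidpoint x z = m at *
  have hinj : Function.Injective (quadDeriv z m).toLinearMap := by
    rw [← LinearMap.ker_eq_bot, LinearMap.ker_eq_bot']
    exact fun k hk => eq_zero_of_mul_inv_mul hz hm hk
  let e := (LinearEquiv.ofInjectiveEndo _ hinj).toContinuousLinearEquiv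
  have hF : HasStrictFDerivAt (fun m => m * z⁻¹ * m)
      (e : Matrix (Fin r) (Fin r) ℝ →L[ℝ] Matrix (Fin r) (Fin r) ℝ) m :=
    hasStrictFDerivAt_quad z m
  refine ⟨e.symm, ?_, fun k => e.symm_apply_apply k⟩
  have h1 := hF.to_localInverse.hasFDerivAt.hasFDerivWithinAt (s := {y | y.PosDef})
  rw [hmx] at h1
  refine h1.congr_of_eventuallyEq ?_ ?_
  · have hc' : Filter.Tendsto (fun y => spdMidpoint y z) (nhdsWithin x {y | y.PosDef})
        (nhds m) := by
      rw [← hm0]; exact hc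
    -- By continuity `c(y)` is near `m`, so the local inverse returns `c(y)` from `Q(c(y)) = y`.
    filter_upwards [hc'.eventually hF.eventually_left_inverse, self_mem_nhdsWithin] with y hy hy1
    rw [(spdMidpoint_spec hy1 hz).2] at hy
    exact hy.symm
  · have := hF.eventually_left_inverse.self_of_nhds
    rw [hmx] at this
    rw [this, hm0]

/-! ### Diagonalising the differential -/

theorem exp_smul_mul_of_mul_eq_smul {r : ℕ} {L W : Matrix (Fin r) (Fin r) ℝ} {c : ℝ}
    (h : L * W = c • W) (t : ℝ) : NormedSpace.exp (t • L) * W = Real.exp (t * c) • W := by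
  have hd : ∀ t, HasDerivAt (fun t : ℝ => Real.exp (-(t * c)) • (NormedSpace.exp (t • L) * W)) 0 t :=
    fun t => by
      refine (((((hasDerivAt_id t).mul_const c).neg).exp).smul
        ((hasDerivAt_exp_smul_const L t).mul_const W)).congr_deriv ?_
      rw [Matrix.mul_assoc, h, mul_smul_comm, smul_smul, ← add_smul]
      simp
  have := is_const_of_deriv_eq_zero (fun t => (hd t).differentiableAt) (fun t => (hd t).deriv) t 0
  simp only [zero_mul, neg_zero, Real.exp_zero, zero_smul, NormedSpace.exp_zero, one_mul,
    one_smul] at this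
  conv_rhs => rw [← this]
  rw [smul_smul, ← Real.exp_add]
  simp

theorem mul_exp_smul_of_mul_eq_smul {r : ℕ} {L W : Matrix (Fin r) (Fin r) ℝ} {c : ℝ}
    (h : W * L = c • W) (t : ℝ) : W * NormedSpace.exp (t • L) = Real.exp (t * c) • W := by
  have h1 : L.transpose * W.transpose = c • W.transpose := by
    rw [← Matrix.transpose_mul, h, Matrix.transpose_smul]
  have h2 := congrArg Matrix.transpose (exp_smul_mul_of_mul_eq_smul h1 t)
  rwa [Matrix.transpose_mul, Matrix.transpose_transpose, ← Matrix.exp_transpose,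
    Matrix.transpose_smul, Matrix.transpose_transpose, Matrix.transpose_smul,
    Matrix.transpose_transpose] at h2

theorem spectral_mul_vecMulVec {r : ℕ} (lam : Fin r → ℝ)
    (v : OrthonormalBasis (Fin r) ℝ (EuclideanSpace ℝ (Fin r))) (i j : Fin r) :
    (∑ k, lam k • Matrix.vecMulVec (v k) (v k)) * Matrix.vecMulVec (v i) (v j) =
      lam i • Matrix.vecMulVec (v i) (v j) := by
  have ho : ∀ k, dotProduct (v k).ofLp (v i).ofLp = if k = i then 1 else 0 := fun k => by
    rw [← orthonormal_iff_ite.1 v.orthonormal k i, EuclideanSpace.inner_eq_star_dotProduct,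
      dotProduct_comm]
    rfl
  rw [Finset.sum_mul]
  simp only [smul_mul_assoc, Matrix.vecMulVec_mul_vecMulVec, ho]
  rw [Finset.sum_eq_single i (fun k _ hk => by simp [hk]) (by simp)]
  simp

theorem isSymm_spectral {r : ℕ} (lam : Fin r → ℝ) (v : Fin r → EuclideanSpace ℝ (Fin r)) :
    (∑ k, lam k • Matrix.vecMulVec (v k) (v k)).IsSymm := by
  simp [Matrix.IsSymm, Matrix.transpose_sum, Matrix.transpose_vecMulVec]

theorem vecMulVec_mul_spectral {r : ℕ} (lam : Fin r → ℝ)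
    (v : OrthonormalBasis (Fin r) ℝ (EuclideanSpace ℝ (Fin r))) (i j : Fin r) :
    Matrix.vecMulVec (v i) (v j) * (∑ k, lam k • Matrix.vecMulVec (v k) (v k)) =
      lam j • Matrix.vecMulVec (v i) (v j) := by
  have h := congrArg Matrix.transpose (spectral_mul_vecMulVec lam v j i)
  rwa [Matrix.transpose_mul, isSymm_spectral, Matrix.transpose_smul,
    Matrix.transpose_vecMulVec] at h

theorem exp_mul_vecMulVec_mul_exp {r : ℕ} (lam : Fin r → ℝ)
    (v : OrthonormalBasis (Fin r) ℝ (EuclideanSpace ℝ (Fin r))) (i j : Fin r) (a b : ℝ) :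
    NormedSpace.exp (a • ∑ k, lam k • Matrix.vecMulVec (v k) (v k)) *
        Matrix.vecMulVec (v i) (v j) *
        NormedSpace.exp (b • ∑ k, lam k • Matrix.vecMulVec (v k) (v k)) =
      Real.exp (a * lam i + b * lam j) • Matrix.vecMulVec (v i) (v j) := by
  rw [exp_smul_mul_of_mul_eq_smul (spectral_mul_vecMulVec lam v i j), smul_mul_assoc,
    mul_exp_smul_of_mul_eq_smul (vecMulVec_mul_spectral lam v i j), smul_smul, Real.exp_add]

/-- The tangent vector `c (v_i v_jᵀ + v_j v_iᵀ)` is an eigenvector of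
`η ↦ exp (a L) η exp (-a L) + exp (-a L) η exp (a L)`. -/
theorem exp_conj_symm_vecMulVec {r : ℕ} (lam : Fin r → ℝ)
    (v : OrthonormalBasis (Fin r) ℝ (EuclideanSpace ℝ (Fin r))) (i j : Fin r) (a c : ℝ)
    {L η : Matrix (Fin r) (Fin r) ℝ} (hL : L = ∑ k, lam k • Matrix.vecMulVec (v k) (v k))
    (hη : η = c • (Matrix.vecMulVec (v i) (v j) + Matrix.vecMulVec (v j) (v i))) :
    NormedSpace.exp (a • L) * η * NormedSpace.exp ((-a) • L) +
        NormedSpace.exp ((-a) • L) * η * NormedSpace.exp (a • L) =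
      (2 * Real.cosh (a * (lam i - lam j))) • η := by
  subst hL hη
  simp only [mul_smul_comm, smul_mul_assoc, mul_add, add_mul, exp_mul_vecMulVec_mul_exp]
  rw [Real.cosh_eq, show a * lam i + -a * lam j = a * (lam i - lam j) by ring,
    show a * lam j + -a * lam i = -(a * (lam i - lam j)) by ring,
    show -a * lam i + a * lam j = -(a * (lam i - lam j)) by ring,
    show -a * lam j + a * lam i = a * (lam i - lam j) by ring]
  module

/-- The left side is `DQ` applied to the parallel field at `2a = T/2`; one factor `exp(-2aL)` turns
a neighbouring `exp(aL)` into `exp(-aL)`. -/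
theorem expField_mul_add_mul {r : ℕ} {s : Matrix (Fin r) (Fin r) ℝ}
    (L η : Matrix (Fin r) (Fin r) ℝ) (hs : s.PosDef) (a : ℝ) :
    expField s L η (2 * a) * (s⁻¹ * NormedSpace.exp ((-(2 * a)) • L) * s) +
        s * NormedSpace.exp ((-(2 * a)) • L) * s⁻¹ * expField s L η (2 * a) =
      s * (NormedSpace.exp (a • L) * η * NormedSpace.exp ((-a) • L) +
        NormedSpace.exp ((-a) • L) * η * NormedSpace.exp (a • L)) * s := by
  have e1 : NormedSpace.exp (a • L) * NormedSpace.exp ((-(2 * a)) • L) =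
      NormedSpace.exp ((-a) • L) := by
    rw [exp_smul_mul_exp_smul]; ring_nf
  have e2 : NormedSpace.exp ((-(2 * a)) • L) * NormedSpace.exp (a • L) =
      NormedSpace.exp ((-a) • L) := by
    rw [exp_smul_mul_exp_smul]; ring_nf
  rw [expField, show 2 * a / 2 = a by ring]
  generalize NormedSpace.exp ((-(2 * a)) • L) = F at *
  generalize NormedSpace.exp (a • L) = E at *
  calc _ = s * E * η * E * (s * s⁻¹) * F * s + s * F * (s⁻¹ * s) * E * η * E * s := by
        noncomm_ring
    _ = s * E * η * (E * F) * s + s * (F * E) * η * E * s := by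
        rw [hs.mul_inv_self, hs.inv_mul_self]; noncomm_ring
    _ = _ := by rw [e1, e2]; noncomm_ring

/-! ### The formula for the differential -/

theorem sinh_div_sinh_two_mul {a : ℝ} (ha : a ≠ 0) :
    Real.sinh a / Real.sinh (2 * a) = (2 * Real.cosh a)⁻¹ := by
  have h1 : Real.sinh a ≠ 0 := Real.sinh_ne_zero.2 ha
  have h2 := (Real.cosh_pos a).ne'
  rw [Real.sinh_two_mul]
  field_simp

theorem corollary3p8 {r : ℕ} (x z : Matrix (Fin r) (Fin r) ℝ) (hx : x.PosDef) (hz : z.PosDef)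
    (hxz : x ≠ z)
    (lam : Fin r → ℝ) (v : OrthonormalBasis (Fin r) ℝ (EuclideanSpace ℝ (Fin r)))
    (hv : (spdSqrt x)⁻¹ * deriv (spdGeodesic x z) 0 * (spdSqrt x)⁻¹ =
      ∑ i, lam i • Matrix.vecMulVec (v i) (v i)) :
    ∃ D : Matrix (Fin r) (Fin r) ℝ →L[ℝ] Matrix (Fin r) (Fin r) ℝ,
      HasFDerivWithinAt (fun y => spdMidpoint y z) D {y | y.PosDef} x ∧
      ∀ i j : Fin r, i ≤ j →
        (lam i = lam j →
          D (spdFrame x v i j) =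
            (1 / 2 : ℝ) •
              spdParallelTransport (spdGeodesic x z) (spdFrame x v i j) (spdDist x z / 2)) ∧
        (lam i ≠ lam j →
          D (spdFrame x v i j) =
            (Real.sinh (spdDist x z / 4 * |lam i - lam j|) /
                Real.sinh (spdDist x z / 2 * |lam i - lam j|)) •
              spdParallelTransport (spdGeodesic x z) (spdFrame x v i j) (spdDist x z / 2)) := by
  obtain ⟨D, hD, hDk⟩ := exists_hasFDerivWithinAt_spdMidpoint hx hz
  refine ⟨D, hD, ?_⟩
  obtain ⟨hγ, -, h0, h1⟩ := spdGeodesic_spec hx hz hxz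
  have hT := spdDist_ne_zero hx hz hxz
  have hs := posDef_spdSqrt hx
  have hγe := hγ.eq_expCurve
  rw [h0, hv] at hγe
  have hL := isSymm_spectral lam v
  generalize hLe : ∑ i, lam i • Matrix.vecMulVec (v i) (v i) = L at hγe hL
  -- The quadratic equation identifies the two midpoints without reparametrizing the unit-speed
  -- geodesic to the unit interval.
  have hmid : spdMidpoint x z = spdGeodesic x z (spdDist x z / 2) := by
    refine eq_spdMidpoint hx hz (hγ.posDef _) ?_
    have h2 := hγ.mul_inv_mul (spdDist x z / 2)
    rwa [mul_div_cancel₀ _ two_ne_zero, h1, h0] at h2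
  -- One formula covers both cases: `cosh 0 = 1` gives the factor `1/2` for equal eigenvalues.
  have key : ∀ i j, D (spdFrame x v i j) =
      (2 * Real.cosh (spdDist x z / 4 * (lam i - lam j)))⁻¹ •
        spdParallelTransport (spdGeodesic x z) (spdFrame x v i j) (spdDist x z / 2) := by
    intro i j
    -- The normalising constant of the frame plays no role, by linearity.
    obtain ⟨c, η, hη, hf⟩ : ∃ (c : ℝ) (η : Matrix (Fin r) (Fin r) ℝ),
        η = c • (Matrix.vecMulVec (v i) (v j) + Matrix.vecMulVec (v j) (v i)) ∧
        spdFrame x v i j = spdSqrt x * η * spdSqrt x := ⟨_, _, rfl, rfl⟩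
    have hηs : η.IsSymm := by
      rw [hη]
      simp [Matrix.IsSymm, Matrix.transpose_vecMulVec, add_comm]
    have hcosh := (Real.cosh_pos (spdDist x z / 4 * (lam i - lam j))).ne'
    have h2 := expCurve_mul_inv_mul L hs (spdDist x z / 2)
    rw [mul_div_cancel₀ _ two_ne_zero, ← hγe, h1, ← hmid] at h2
    have h3 := hDk (expField (spdSqrt x) L η (spdDist x z / 2))
    rw [h2.1, h2.2, show spdDist x z / 2 = 2 * (spdDist x z / 4) by ring,
      expField_mul_add_mul L η hs, exp_conj_symm_vecMulVec lam v i j _ c hLe.symm hη,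
      mul_smul_comm, smul_mul_assoc, map_smul] at h3
    rw [hf, hγe, spdParallelTransport_expCurve hs hL hηs,
      show spdDist x z / 2 = 2 * (spdDist x z / 4) by ring, ← h3, inv_smul_smul₀ (by positivity)]
  refine fun i j _ => ⟨fun hij => ?_, fun hij => ?_⟩
  · rw [key, hij]
    simp
  · have ha : spdDist x z / 4 * |lam i - lam j| ≠ 0 :=
      mul_ne_zero (div_ne_zero hT four_ne_zero) (abs_ne_zero.2 (sub_ne_zero.2 hij))
    rw [key, show spdDist x z / 2 * |lam i - lam j| = 2 * (spdDist x z / 4 * |lam i - lam j|) by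
      ring, sinh_div_sinh_two_mul ha]
    rcases abs_choice (lam i - lam j) with h | h <;> rw [h]
    rw [mul_neg, Real.cosh_neg]
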